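/- \textbf{Setting.} Let $S^2\subset\mathbb R^3$ be the unit sphere with its standard surface measure $d\sigma$, and write $m=(m_x,m_z)\in S^2$ with $m_x\in\mathbb R^2$, $m_z\in\mathbb R$. Let $D\subset S^2$ be open (in $S^2$) and nonempty, with closure $\bar D$ such that $(0,0,1),(0,0,-1)\notin\bar D$. Let $T\subset\mathbb R^2$ be open, bounded and nonempty, with closure $\bar T$. Let $\ell>0$ satisfy $\ell>\max_{x\in\bar T}|x|$ and $$\frac{\ell-\langle m_x,x\rangle}{(\ell^2-|x|^2)(1+m_z)}-\frac1{2\ell}>0\qquad\text{for all }m\in\bar D,\ x\in\bar T .$$ Put $\delta=\frac1{2\ell}$ and $$K(m,x)=\delta\,\frac{\ell-\langle m_x,x\rangle}{(\ell^2-|x|^2)(1+m_z)}-\delta^2\qquad(m\in\bar D,\ x\in\bar T).$$ For a continuous $\rho:\bar D\to(0,\infty)$ and a continuous $z:\bar T\to\mathbb R$ put $$\hat\rho(m)=-\delta+\frac1{2\rho(m)(m_z+1)},\qquad \tilde z(x)=\delta-\frac{z(x)}{\ell^2-|x|^2}.$$ The pair $(\rho,z)$ is called a \emph{reflector pair} if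 $\hat\rho>0$ on $\bar D$, $\tilde z>0$ on $\bar T$, and $$\hat\rho(m)=\sup_{x\in\bar T}\frac{K(m,x)}{\tilde z(x)}\quad(m\in\bar D),\qquad \tilde z(x)=\sup_{m\in\bar D}\frac{K(m,x)}{\hat\rho(m)}\quad(x\in\bar T).$$ Its \emph{reflector map} (ray-tracing map) is the set-valued map $$\gamma(m)=\Big\{x\in\bar T:\ \hat\rho(m)=\frac{K(m,x)}{\tilde z(x)}\Big\},\quad m\in\bar D,\qquad \gamma^{-1}(\tau)=\{m\in\bar D:\gamma(m)\cap\tau\neq\emptyset\}\quad(\tau\subseteq\bar T).$$ Let $I$ on $\bar D$ and $L$ on $\bar T$ be nonnegative integrable functions with $\int_{\bar D}I\,d\sigma=\int_{\bar T}L\,dx$. A \emph{solution of the reflector problem} is a reflector pair $(\rho,z)$ such that $$\int_{\gamma^{-1}(\tau)}I(m)\,d\sigma=\int_\tau L(x)\,dx\qquad\text{for every Borel set }\tau\subseteq\bar T .$$ \textbf{Theorem.} (Existence and uniqueness for solutions to the reflector problem.) (1) The reflector problem has a solution. (2) If $(\rho,z)$ is a solution, then $\rho$ is Lipschitz continuous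 on $\bar D$, $z$ is Lipschitz continuous on $\bar T$, and $\gamma(m)$ consists of exactly one point for $\sigma$-almost every $m\in\bar D$. (3) If $(\rho,z)$ and $(\rho',z')$ are two solutions with reflector maps $\gamma$ and $\gamma'$, then $\gamma(m)=\gamma'(m)$ for $\sigma$-almost every $m\in\bar D$ with $I(m)>0$. -/

import Mathlib

open MeasureTheory Set

noncomputable section

namespace TwoReflector

/-- The plane `ℝ²` with its Euclidean norm. -/
abbrev Plane : Type := EuclideanSpace ℝ (Fin 2)

/-- The unit sphere `S² ⊆ ℝ³`. -/
abbrev Sphere2 : Type := Metric.sphere (0 : EuclideanSpace ℝ (Fin 3)) 1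

/-- The standard surface measure `dσ` on `S²` (total mass `4π`). -/
def surfaceMeasure : Measure Sphere2 :=
  (volume : Measure (EuclideanSpace ℝ (Fin 3))).toSphere

/-- The horizontal part `m_x ∈ ℝ²` of `m = (m_x, m_z) ∈ S²`. -/
def horiz (m : Sphere2) : Plane := !₂[m.1 0, m.1 1]

/-- The vertical part `m_z` of `m = (m_x, m_z) ∈ S²`. -/
def vert (m : Sphere2) : ℝ := m.1 2

/-- The constant `δ = 1 / (2ℓ)`. -/
def delta (ℓ : ℝ) : ℝ := 1 / (2 * ℓ)

/-- The transform `z̃(x) = δ - z(x) / (ℓ² - |x|²)`. -/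
def zTilde (ℓ : ℝ) (z : Plane → ℝ) (x : Plane) : ℝ :=
  delta ℓ - z x / (ℓ ^ 2 - ‖x‖ ^ 2)

/-- The transform `ρ̂(m) = -δ + 1 / (2 ρ(m) (m_z + 1))`. -/
def rhoHat (ℓ : ℝ) (ρ : Sphere2 → ℝ) (m : Sphere2) : ℝ :=
  -delta ℓ + 1 / (2 * ρ m * (vert m + 1))

/-- The kernel `K(m, x) = δ (ℓ - ⟨m_x, x⟩) / ((ℓ² - |x|²) (1 + m_z)) - δ²`. -/
def kernelK (ℓ : ℝ) (m : Sphere2) (x : Plane) : ℝ :=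
  delta ℓ * ((ℓ - inner ℝ (horiz m) x) / ((ℓ ^ 2 - ‖x‖ ^ 2) * (1 + vert m))) - delta ℓ ^ 2

/-- Reflector pairs. A function on `closure D` or `closure T` is represented by a function on the
ambient space, of which only the values on `closure D`, respectively `closure T`, are used. -/
structure IsReflectorPair (ℓ : ℝ) (D : Set Sphere2) (T : Set Plane)
    (ρ : Sphere2 → ℝ) (z : Plane → ℝ) : Prop where
  continuousOn_rho : ContinuousOn ρ (closure D)
  rho_pos : ∀ m ∈ closure D, 0 < ρ m
  continuousOn_z : ContinuousOn z (closure T)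
  rhoHat_pos : ∀ m ∈ closure D, 0 < rhoHat ℓ ρ m
  zTilde_pos : ∀ x ∈ closure T, 0 < zTilde ℓ z x
  rhoHat_sup : ∀ m ∈ closure D,
    IsLUB ((fun x => 1 / zTilde ℓ z x * kernelK ℓ m x) '' closure T) (rhoHat ℓ ρ m)
  zTilde_sup : ∀ x ∈ closure T,
    IsLUB ((fun m => 1 / rhoHat ℓ ρ m * kernelK ℓ m x) '' closure D) (zTilde ℓ z x)

/-- The set-valued reflector map
`γ(m) = {x ∈ closure T | ρ̂(m) = K(m, x) / z̃(x)}`, used for `m ∈ closure D`. -/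
def reflectorMap (ℓ : ℝ) (T : Set Plane) (ρ : Sphere2 → ℝ) (z : Plane → ℝ)
    (m : Sphere2) : Set Plane :=
  {x | x ∈ closure T ∧ rhoHat ℓ ρ m = 1 / zTilde ℓ z x * kernelK ℓ m x}

/-- The preimage `γ⁻¹(τ) ⊆ closure D` of `τ` under the set-valued reflector map. -/
def reflectorPreimage (ℓ : ℝ) (D : Set Sphere2) (T : Set Plane)
    (ρ : Sphere2 → ℝ) (z : Plane → ℝ) (τ : Set Plane) : Set Sphere2 :=
  {m | m ∈ closure D ∧ (reflectorMap ℓ T ρ z m ∩ τ).Nonempty}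

/-- Solutions of the reflector problem: reflector pairs with local energy conservation. -/
structure IsSolution (ℓ : ℝ) (D : Set Sphere2) (T : Set Plane) (I : Sphere2 → ℝ) (L : Plane → ℝ)
    (ρ : Sphere2 → ℝ) (z : Plane → ℝ) : Prop where
  isReflectorPair : IsReflectorPair ℓ D T ρ z
  energy : ∀ τ : Set Plane, MeasurableSet τ → τ ⊆ closure T →
    ∫ m in reflectorPreimage ℓ D T ρ z τ, I m ∂surfaceMeasure = ∫ x in τ, L x

end TwoReflector

end

/-!
The reflector problem is an optimal transport problem between `I dσ` and `L dx`. With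
`u = log ρ̂`, `v = log z̃` and `k = log K`, reflector pairs are exactly the pairs of conjugate
potentials `u(m) = sup_x (k(m, x) - v(x))`, `v(x) = sup_m (k(m, x) - u(m))`, the set `γ(m)` consists
of the `x` with `u(m) + v(x) = k(m, x)`, and energy conservation says that `γ` transports `I dσ` to
`L dx` (`IsReflectorPair.isConjugatePair`, `exists_isReflectorPair`,
`IsReflectorPair.isSolution_iff_map_eq`).

*Regularity.* `ρ̂` and `z̃` are suprema of families with a common Lipschitz constant, hence
Lipschitz, and `ρ(m)` and `z(x)` are smooth functions of `(m, ρ̂(m))` and of `(x, z̃(x))`.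

*Single-valuedness.* Multiplying by `1 + m_z` turns `K(m, x) / z̃(x)` into the restriction to the
sphere of a positively homogeneous function `a(x) |p| + ⟪b(x), p⟫` of `p ∈ ℝ³`. The supremum over
`x` is Lipschitz on `ℝ³`, so it is differentiable almost everywhere, and by homogeneity at almost
every point of the sphere; there all maximising `x` give the same gradient
(`ae_toSphere_gradient_eq`). The gradient determines `x`, because in terms of the stereographic
projection `y = m_x / (1 + m_z)` the kernel is `δ² |x - ℓ y|² / (ℓ² - |x|²)` and inversion in a
circle is injective (`eq_of_gradient_eq`). Hence `γ(m)` is a single point for almost every `m`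
(`ae_maximizer_unique`).

*Existence.* The dual functional `∫ u I dσ + ∫ v L dx`, with `u` the transform of `v`, attains its
minimum on a compact set of Lipschitz functions, and there is a minimiser which is a conjugate pair
(`exists_isConjugatePair_minimizer`). Its first variation in the direction `f`, computed with
dominated convergence and the single-valuedness of `γ`, is `∫ f L dx - ∫ f(γ(m)) I dσ`, so `γ`
transports `I dσ` to `L dx` (`IsConjugatePair.map_eq_of_minimizer`).

*Uniqueness.* For two solutions, integrating `u'(m) + v'(γ(m)) ≥ k(m, γ(m)) = u(m) + v(γ(m))`
against `I dσ` and exchanging the roles of the solutions shows that equality holds almost everywhere with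
respect to `I dσ`, i.e. `γ(m) ⊆ γ'(m)` there (`IsConjugatePair.ae_eq_of_map_eq`).
-/

open Filter Topology

namespace TwoReflector

/-! ### Kantorovich duality on compact spaces -/

section Transport

variable {X Y : Type*}

/-- The transform `v ↦ sup_y (k(·, y) - v(y))` of a potential `v` with respect to the kernel `k`. -/
noncomputable def cTransform (k : X → Y → ℝ) (v : Y → ℝ) (m : X) : ℝ := ⨆ y, (k m y - v y)

/-- Pairs of continuous potentials with `u(m) + v(y) ≥ k(m, y)` such that every `m` and every `y`
occurs in some contact pair, i.e. a pair `(m, y)` with equality. On compact spaces these are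
exactly the pairs of continuous functions which are transforms of each other. -/
structure IsConjugatePair [TopologicalSpace X] [TopologicalSpace Y]
    (k : X → Y → ℝ) (u : X → ℝ) (v : Y → ℝ) : Prop where
  continuous_left : Continuous u
  continuous_right : Continuous v
  le_add : ∀ m y, k m y ≤ u m + v y
  exists_right : ∀ m, ∃ y, k m y = u m + v y
  exists_left : ∀ y, ∃ m, k m y = u m + v y

lemma cTransform_le [Nonempty Y] {k : X → Y → ℝ} {v : Y → ℝ} {m : X} {a : ℝ}
    (h : ∀ y, k m y ≤ a + v y) : cTransform k v m ≤ a :=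
  ciSup_le fun y => by linarith [h y]

section Basic

variable [TopologicalSpace X] [TopologicalSpace Y] [CompactSpace Y]
  {k : X → Y → ℝ} {v v' : Y → ℝ}

lemma le_cTransform_add (hk : Continuous (Function.uncurry k)) (hv : Continuous v) (m : X) (y : Y) :
    k m y ≤ cTransform k v m + v y := by
  have hc : Continuous fun y => k m y - v y :=
    (hk.comp (Continuous.prodMk_right m)).sub hv
  have := le_ciSup (isCompact_range hc).bddAbove y
  have h2 : k m y - v y ≤ cTransform k v m := this
  linarith

lemma exists_cTransform_eq [Nonempty Y] (hk : Continuous (Function.uncurry k)) (hv : Continuous v)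
    (m : X) : ∃ y, k m y = cTransform k v m + v y := by
  have hc : Continuous fun y => k m y - v y :=
    (hk.comp (Continuous.prodMk_right m)).sub hv
  obtain ⟨y, hy⟩ := (isCompact_range hc).sSup_mem (range_nonempty _)
  have h2 : k m y - v y = cTransform k v m := hy
  exact ⟨y, by linarith⟩

lemma continuous_cTransform (hk : Continuous (Function.uncurry k))
    (hv : Continuous v) : Continuous (cTransform k v) := by
  have h : Continuous (Function.uncurry fun (m : X) (y : Y) => k m y - v y) :=
    hk.sub (hv.comp continuous_snd)
  have := IsCompact.continuous_sSup (f := fun (m : X) (y : Y) => k m y - v y) isCompact_univ h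
  simp only [image_univ] at this
  exact this

lemma cTransform_le_add [Nonempty Y] (hk : Continuous (Function.uncurry k)) (hv : Continuous v)
    {a : ℝ} (h : ∀ y, v y ≤ v' y + a) (m : X) : cTransform k v' m ≤ cTransform k v m + a :=
  cTransform_le fun y => by linarith [le_cTransform_add hk hv m y, h y]

lemma cTransform_sub_const [Nonempty Y] (hk : Continuous (Function.uncurry k)) (hv : Continuous v)
    (a : ℝ) (m : X) : cTransform k (fun y => v y - a) m = cTransform k v m + a := by
  apply le_antisymm
  · exact cTransform_le_add hk hv (fun y => by linarith) m
  · have hv' : Continuous fun y => v y - a := hv.sub continuous_const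
    have := cTransform_le_add (v' := v) (a := -a) hk hv' (fun y => by linarith) m
    linarith

end Basic

lemma continuous_uncurry_swap [TopologicalSpace X] [TopologicalSpace Y] {k : X → Y → ℝ}
    (hk : Continuous (Function.uncurry k)) :
    Continuous (Function.uncurry fun y m => k m y) :=
  hk.comp continuous_swap

/-- If almost every `m` is in contact with only one point, this point can be chosen measurably. -/
theorem IsConjugatePair.exists_measurable_contact [TopologicalSpace X] [MeasurableSpace X]
    [BorelSpace X] [MetricSpace Y] [CompactSpace Y] [MeasurableSpace Y] [BorelSpace Y]
    {k : X → Y → ℝ} {u : X → ℝ} {v : Y → ℝ} (h : IsConjugatePair k u v)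
    (hk : Continuous (Function.uncurry k)) {μ : Measure X}
    (huniq : ∀ᵐ m ∂μ, ∀ y y', k m y = u m + v y → k m y' = u m + v y' → y = y') :
    ∃ g : X → Y, Measurable g ∧ ∀ᵐ m ∂μ, ∀ y, k m y = u m + v y ↔ y = g m := by
  choose g hg using h.exists_right
  have hcl : IsClosed {p : X × Y | k p.1 p.2 = u p.1 + v p.2} :=
    isClosed_eq hk ((h.continuous_left.comp continuous_fst).add
      (h.continuous_right.comp continuous_snd))
  have hnull : NullMeasurable g μ := by
    refine @measurable_of_isClosed _ _ _ _ _ (eventuallyMeasurableSpace _ (ae μ)) _ fun F hF => ?_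
    -- Up to a null set, `g ⁻¹' F` is the projection of a closed set.
    have hproj : IsClosed
        (Prod.fst '' ({p : X × Y | k p.1 p.2 = u p.1 + v p.2} ∩ Prod.snd ⁻¹' F)) :=
      isClosedMap_fst_of_compactSpace _ (hcl.inter (hF.preimage continuous_snd))
    have : NullMeasurableSet (g ⁻¹' F) μ := by
      refine hproj.measurableSet.nullMeasurableSet.congr ?_
      filter_upwards [huniq] with m hm
      apply propext
      constructor
      · rintro ⟨⟨m', y⟩, ⟨hy, hyF⟩, rfl⟩
        have : y = g m' := hm y (g m') hy (hg m')
        exact (this ▸ hyF : g m' ∈ F)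
      · intro hF'
        exact ⟨(m, g m), ⟨hg m, hF'⟩, rfl⟩
    exact this
  obtain ⟨g', hg', hgg'⟩ := hnull.aemeasurable
  refine ⟨g', hg', ?_⟩
  filter_upwards [huniq, hgg'] with m hm hm' y
  rw [← hm']
  exact ⟨fun hy => hm _ _ hy (hg m), fun hy => hy ▸ hg m⟩

variable [TopologicalSpace X] [CompactSpace X] {k : X → Y → ℝ}

/-- A potential can be replaced by its double transform, which lies below it and forms a conjugate
pair with the transform. -/
lemma isConjugatePair_cTransform [Nonempty X] [TopologicalSpace Y] [CompactSpace Y] [Nonempty Y]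
    (hk : Continuous (Function.uncurry k)) {v : Y → ℝ} (hv : Continuous v) :
    IsConjugatePair k (cTransform k v) (cTransform (fun y m => k m y) (cTransform k v)) ∧
      ∀ y, cTransform (fun y m => k m y) (cTransform k v) y ≤ v y := by
  have hu := continuous_cTransform hk hv
  have hk' := continuous_uncurry_swap hk
  have hle : ∀ y, cTransform (fun y m => k m y) (cTransform k v) y ≤ v y := fun y =>
    cTransform_le fun m => by linarith [le_cTransform_add hk hv m y]
  have hadd : ∀ m y, k m y ≤ cTransform k v m + cTransform (fun y m => k m y) (cTransform k v) y :=
    fun m y => by linarith [le_cTransform_add hk' hu y m]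
  refine ⟨⟨hu, continuous_cTransform hk' hu, hadd, fun m => ?_, fun y => ?_⟩, hle⟩
  · obtain ⟨y, hy⟩ := exists_cTransform_eq hk hv m
    exact ⟨y, le_antisymm (hadd m y) (by linarith [hle y])⟩
  · obtain ⟨m, hm⟩ := exists_cTransform_eq hk' hu y
    exact ⟨m, by linarith⟩

lemma lipschitzWith_cTransform_swap [Nonempty X] [PseudoMetricSpace Y] {C : NNReal}
    (hk : Continuous (Function.uncurry k)) (hC : ∀ m, LipschitzWith C (k m))
    {u : X → ℝ} (hu : Continuous u) : LipschitzWith C (cTransform (fun y m => k m y) u) := by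
  refine LipschitzWith.of_le_add_mul C fun y y' => cTransform_le fun m => ?_
  have h1 := le_cTransform_add (continuous_uncurry_swap hk) hu y' m
  have h2 := (hC m).dist_le_mul y y'
  rw [Real.dist_eq] at h2
  have h3 := (abs_le.1 h2).2
  linarith

variable [MetricSpace Y] [CompactSpace Y]

/-- Arzelà–Ascoli: the normalised potentials with a given Lipschitz constant form a compact set,
over which the dual functional is minimised. -/
lemma isCompact_setOf_lipschitzWith (C : NNReal) (y₀ : Y) :
    IsCompact {v : BoundedContinuousFunction Y ℝ | LipschitzWith C v ∧ v y₀ = 0} := by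
  have hcl : IsClosed {v : BoundedContinuousFunction Y ℝ | LipschitzWith C v ∧ v y₀ = 0} := by
    have : {v : BoundedContinuousFunction Y ℝ | LipschitzWith C v ∧ v y₀ = 0} =
        (⋂ y, ⋂ y', {v | dist (v y) (v y') ≤ C * dist y y'}) ∩ {v | v y₀ = 0} := by
      ext v
      simp [lipschitzWith_iff_dist_le_mul]
    rw [this]
    refine IsClosed.inter (isClosed_iInter fun y => isClosed_iInter fun y' => ?_) ?_
    · exact isClosed_le (((continuous_apply _).comp BoundedContinuousFunction.continuous_coe).dist
        ((continuous_apply _).comp BoundedContinuousFunction.continuous_coe)) continuous_const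
    · exact isClosed_eq ((continuous_apply _).comp BoundedContinuousFunction.continuous_coe)
        continuous_const
  refine BoundedContinuousFunction.arzela_ascoli₂
    (Metric.closedBall 0 (C * Metric.diam (univ : Set Y))) (isCompact_closedBall _ _) _ hcl ?_ ?_
  · rintro v y ⟨hv, h0⟩
    rw [Metric.mem_closedBall, ← h0]
    refine (hv.dist_le_mul y y₀).trans ?_
    gcongr
    exact Metric.dist_le_diam_of_mem isCompact_univ.isBounded (mem_univ _) (mem_univ _)
  · exact (LipschitzWith.uniformEquicontinuous _ C fun v => v.2.1).equicontinuous

variable [MeasurableSpace X] [BorelSpace X] [MeasurableSpace Y] [BorelSpace Y]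

/-- Existence of a minimiser of the Kantorovich dual functional which is a conjugate pair. -/
theorem exists_isConjugatePair_minimizer [Nonempty X] [Nonempty Y] {μ : Measure X} {ν : Measure Y}
    [IsFiniteMeasure μ] [IsFiniteMeasure ν] (hmass : μ univ = ν univ)
    (hk : Continuous (Function.uncurry k))
    {C : NNReal} (hC : ∀ m, LipschitzWith C (k m)) :
    ∃ u v, IsConjugatePair k u v ∧ ∀ w : Y → ℝ, Continuous w →
      ∫ m, u m ∂μ + ∫ y, v y ∂ν ≤ ∫ m, cTransform k w m ∂μ + ∫ y, w y ∂ν := by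
  have intX : ∀ {f : X → ℝ}, Continuous f → Integrable f μ := fun hf =>
    hf.integrable_of_hasCompactSupport (HasCompactSupport.of_compactSpace _)
  have intY : ∀ {f : Y → ℝ}, Continuous f → Integrable f ν := fun hf =>
    hf.integrable_of_hasCompactSupport (HasCompactSupport.of_compactSpace _)
  obtain ⟨y₀⟩ := ‹Nonempty Y›
  have : Nonempty Y := ⟨y₀⟩
  let Φ : (Y → ℝ) → ℝ := fun w => ∫ m, cTransform k w m ∂μ + ∫ y, w y ∂ν
  have hreal : μ.real univ = ν.real univ := by simp [Measure.real, hmass]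
  -- The functional is continuous for uniform convergence.
  have hΦ : Continuous fun v : BoundedContinuousFunction Y ℝ => Φ v := by
    refine (LipschitzWith.of_le_add_mul
      (μ.real univ + ν.real univ).toNNReal fun v w => ?_).continuous
    have h1 : ∀ y, w y ≤ v y + dist v w := fun y => by
      have := (abs_le.1 ((Real.dist_eq _ _) ▸ v.dist_coe_le_dist (g := w) y)).1
      linarith
    have h2 : ∀ y, v y ≤ w y + dist v w := fun y => by
      have := (abs_le.1 ((Real.dist_eq _ _) ▸ v.dist_coe_le_dist (g := w) y)).2
      linarith
    have h3 : ∫ m, cTransform k v m ∂μ ≤ ∫ m, (cTransform k w m + dist v w) ∂μ :=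
      integral_mono (intX (continuous_cTransform hk v.continuous))
        (intX ((continuous_cTransform hk w.continuous).add continuous_const))
        fun m => cTransform_le_add hk w.continuous h1 m
    have h4 : ∫ y, v y ∂ν ≤ ∫ y, (w y + dist v w) ∂ν :=
      integral_mono (intY v.continuous) (intY (w.continuous.add continuous_const)) h2
    rw [integral_add (intX (continuous_cTransform hk w.continuous)) (integrable_const _),
      integral_const, smul_eq_mul] at h3
    rw [integral_add (intY w.continuous) (integrable_const _), integral_const, smul_eq_mul] at h4
    rw [Real.coe_toNNReal _ (by positivity)]
    simp only [Φ]
    linarith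
  obtain ⟨v, -, hvmin⟩ := (isCompact_setOf_lipschitzWith C y₀).exists_isMinOn
    ⟨0, LipschitzWith.const' (0 : ℝ), rfl⟩ hΦ.continuousOn
  -- Passing to the double transform does not increase `Φ`, and subtracting a constant does not
  -- change it as the masses are equal, so `v` minimises `Φ` among all potentials.
  have key : ∀ w : Y → ℝ, Continuous w → Φ v ≤ Φ w := by
    intro w hw
    obtain ⟨hconj, hle⟩ := isConjugatePair_cTransform hk hw
    set w₂ := cTransform (fun y m => k m y) (cTransform k w) with hw₂
    have hw₂c : Continuous w₂ := hconj.continuous_right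
    have hlip : LipschitzWith C w₂ := lipschitzWith_cTransform_swap hk hC hconj.continuous_left
    let w₃ : BoundedContinuousFunction Y ℝ :=
      BoundedContinuousFunction.mkOfCompact ⟨fun y => w₂ y - w₂ y₀, hw₂c.sub continuous_const⟩
    have hw₃ : Φ v ≤ Φ w₃ := hvmin (a := w₃) ⟨by
      refine LipschitzWith.of_dist_le_mul fun y y' => ?_
      simpa [w₃] using hlip.dist_le_mul y y', by simp [w₃]⟩
    have h1 : Φ w₃ = Φ w₂ := by
      have e1 : ∀ m, cTransform k w₃ m = cTransform k w₂ m + w₂ y₀ :=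
        cTransform_sub_const hk hw₂c _
      have e2 : ∀ y, w₃ y = w₂ y - w₂ y₀ := fun _ => rfl
      simp only [Φ, e1, e2]
      rw [integral_add (intX (continuous_cTransform hk hw₂c)) (integrable_const _),
        integral_sub (intY hw₂c) (integrable_const _), integral_const, integral_const, hreal]
      ring
    have h2 : Φ w₂ ≤ Φ w := by
      refine add_le_add (integral_mono (intX (continuous_cTransform hk hw₂c))
        (intX hconj.continuous_left) fun m => ?_) (integral_mono (intY hw₂c) (intY hw) hle)
      exact cTransform_le fun y => hconj.le_add m y
    linarith
  obtain ⟨hconj, hle⟩ := isConjugatePair_cTransform hk v.continuous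
  refine ⟨_, _, hconj, fun w hw => le_trans ?_ (key w hw)⟩
  have := integral_mono (intY hconj.continuous_right) (intY v.continuous) hle
  simp only [Φ]
  linarith

/-- First variation: the contact map of a minimiser of the dual functional transports `μ` to `ν`. -/
theorem IsConjugatePair.map_eq_of_minimizer [Nonempty Y] {μ : Measure X} {ν : Measure Y}
    [IsFiniteMeasure μ] [IsFiniteMeasure ν] (hk : Continuous (Function.uncurry k))
    {u : X → ℝ} {v : Y → ℝ} (h : IsConjugatePair k u v)
    (hmin : ∀ w : Y → ℝ, Continuous w →
      ∫ m, u m ∂μ + ∫ y, v y ∂ν ≤ ∫ m, cTransform k w m ∂μ + ∫ y, w y ∂ν)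
    {g : X → Y} (hg : Measurable g) (hcontact : ∀ᵐ m ∂μ, ∀ y, k m y = u m + v y ↔ y = g m) :
    μ.map g = ν := by
  have intX : ∀ {f : X → ℝ}, Continuous f → Integrable f μ := fun hf =>
    hf.integrable_of_hasCompactSupport (HasCompactSupport.of_compactSpace _)
  have intY : ∀ {f : Y → ℝ}, Continuous f → Integrable f ν := fun hf =>
    hf.integrable_of_hasCompactSupport (HasCompactSupport.of_compactSpace _)
  have key : ∀ f : BoundedContinuousFunction Y ℝ, ∫ m, f (g m) ∂μ ≤ ∫ y, f y ∂ν := by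
    intro f
    let ε : ℕ → ℝ := fun n => 1 / ((n : ℝ) + 1)
    have hε : ∀ n, 0 < ε n := fun n => by positivity
    have hε0 : Tendsto ε atTop (𝓝 0) := tendsto_one_div_add_atTop_nhds_zero_nat
    have hw : ∀ n, Continuous fun y => v y + ε n * f y := fun n =>
      h.continuous_right.add (continuous_const.mul f.continuous)
    -- A point where the supremum in the perturbed transform is attained.
    choose q hq using fun n m => exists_cTransform_eq hk (hw n) m
    let F : ℕ → X → ℝ := fun n m => (cTransform k (fun y => v y + ε n * f y) m - u m) / ε n
    have hFc : ∀ n, Continuous (F n) := fun n =>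
      ((continuous_cTransform hk (hw n)).sub h.continuous_left).div_const _
    have hF_le : ∀ n m, F n m ≤ - f (q n m) := fun n m => by
      rw [div_le_iff₀ (hε n)]
      have := h.le_add m (q n m)
      have := hq n m
      linarith
    have hle_F : ∀ n m y, k m y = u m + v y → - f y ≤ F n m := fun n m y hy => by
      rw [le_div_iff₀ (hε n)]
      have := le_cTransform_add hk (hw n) m y
      linarith
    have hlim : Tendsto (fun n => ∫ m, F n m ∂μ) atTop (𝓝 (∫ m, - f (g m) ∂μ)) := by
      refine tendsto_integral_of_dominated_convergence (fun _ => ‖f‖)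
        (fun n => (hFc n).aestronglyMeasurable) (integrable_const _) (fun n => ?_) ?_
      · filter_upwards with m
        obtain ⟨y, hy⟩ := h.exists_right m
        have h1 := hF_le n m
        have h2 := hle_F n m y hy
        have h3 := (abs_le.1 (f.norm_coe_le_norm (q n m))).1
        have h4 := (abs_le.1 (f.norm_coe_le_norm y)).2
        rw [Real.norm_eq_abs, abs_le]
        constructor <;> linarith
      · filter_upwards [hcontact] with m hm
        -- The perturbed maximisers converge to the unique contact point.
        have hqlim : Tendsto (fun n => q n m) atTop (𝓝 (g m)) := by
          refine isCompact_univ.tendsto_nhds_of_unique_mapClusterPt (by simp) fun y _ hy => ?_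
          refine (hm y).1 (le_antisymm (h.le_add m y) ?_)
          have hsub : ∀ n, u m + v (q n m) ≤ k m (q n m) + 2 * ε n * ‖f‖ := fun n => by
            have h1 := hq n m
            have h2 := hle_F n m (g m) ((hm _).2 rfl)
            rw [le_div_iff₀ (hε n)] at h2
            have h3 := (abs_le.1 (f.norm_coe_le_norm (q n m))).1
            have h4 := (abs_le.1 (f.norm_coe_le_norm (g m))).2
            have h5 := mul_le_mul_of_nonneg_left h3 (hε n).le
            have h6 := mul_le_mul_of_nonneg_left h4 (hε n).le
            linarith
          have hkm : Continuous (k m) := hk.comp (Continuous.prodMk_right m)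
          by_contra! hlt
          obtain ⟨c, hc0, hc⟩ : ∃ c, 0 < c ∧ k m y + c < u m + v y :=
            ⟨(u m + v y - k m y) / 2, by linarith, by linarith⟩
          have hopen : ∀ᶠ y' in 𝓝 y, k m y' + c < u m + v y' :=
            (hkm.add continuous_const).continuousAt.eventually_lt
              (continuous_const.add h.continuous_right).continuousAt hc
          have hsmall : ∀ᶠ n in atTop, 2 * ε n * ‖f‖ < c := by
            have : Tendsto (fun n => 2 * ε n * ‖f‖) atTop (𝓝 (2 * 0 * ‖f‖)) :=
              (hε0.const_mul 2).mul_const _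
            rw [mul_zero, zero_mul] at this
            exact this.eventually_lt_const hc0
          obtain ⟨n, hn1, hn2⟩ := ((hy.frequently hopen).and_eventually hsmall).exists
          linarith [hsub n]
        refine tendsto_of_tendsto_of_tendsto_of_le_of_le tendsto_const_nhds
          ((f.continuous.tendsto _).comp hqlim).neg (fun n => hle_F n m _ ((hm _).2 rfl))
          fun n => hF_le n m
    have hnonneg : ∀ n, 0 ≤ ∫ m, F n m ∂μ + ∫ y, f y ∂ν := fun n => by
      have h1 := hmin _ (hw n)
      rw [integral_add (intY h.continuous_right)
        (intY (f := fun y => ε n * f y) (continuous_const.mul f.continuous)),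
        integral_const_mul] at h1
      simp only [F]
      rw [integral_div, integral_sub (intX (continuous_cTransform hk (hw n)))
        (intX h.continuous_left), div_add' _ _ _ (hε n).ne']
      refine div_nonneg ?_ (hε n).le
      linarith
    have := ge_of_tendsto' (hlim.add_const (∫ y, f y ∂ν)) hnonneg
    rw [integral_neg] at this
    linarith
  refine ext_of_forall_integral_eq_of_IsFiniteMeasure fun f => ?_
  rw [integral_map hg.aemeasurable f.continuous.aestronglyMeasurable]
  refine le_antisymm (key f) ?_
  have := key (-f)
  simp only [BoundedContinuousFunction.coe_neg, Pi.neg_apply, integral_neg] at this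
  linarith

/-- Two contact maps with the same image measure agree: both dual pairs are optimal, so each
contact map also consists of contact points of the other pair. -/
theorem IsConjugatePair.ae_eq_of_map_eq {μ : Measure X} [IsFiniteMeasure μ]
    {u u' : X → ℝ} {v v' : Y → ℝ} (h : IsConjugatePair k u v) (h' : IsConjugatePair k u' v')
    {g g' : X → Y} (hg : Measurable g) (hg' : Measurable g')
    (hc : ∀ᵐ m ∂μ, ∀ y, k m y = u m + v y ↔ y = g m)
    (hc' : ∀ᵐ m ∂μ, ∀ y, k m y = u' m + v' y ↔ y = g' m)
    (hmap : μ.map g = μ.map g') : g =ᵐ[μ] g' := by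
  have intX : ∀ {f : X → ℝ}, Continuous f → Integrable f μ := fun hf =>
    hf.integrable_of_hasCompactSupport (HasCompactSupport.of_compactSpace _)
  have intY : ∀ {f : Y → ℝ} {g : X → Y}, Continuous f → Measurable g →
      Integrable (fun m => f (g m)) μ := fun {f g} hf hg =>
    (hf.integrable_of_hasCompactSupport (HasCompactSupport.of_compactSpace f)
      (μ := μ.map g)).comp_measurable hg
  have hpush : ∀ {f : Y → ℝ}, Continuous f → ∫ m, f (g m) ∂μ = ∫ m, f (g' m) ∂μ := fun {f} hf => by
    rw [← integral_map hg.aemeasurable hf.aestronglyMeasurable, hmap,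
      integral_map hg'.aemeasurable hf.aestronglyMeasurable]
  have i1 := intX h.continuous_left
  have i2 := intX h'.continuous_left
  have i3 := intY h.continuous_right hg
  have i4 := intY h'.continuous_right hg
  have i5 := intY h.continuous_right hg'
  have i6 := intY h'.continuous_right hg'
  -- The optimality gap of `(u', v')` along the contact map `g` is nonnegative with integral `≤ 0`.
  have hgap0 : 0 ≤ᵐ[μ] fun m => (u' m + v' (g m)) - (u m + v (g m)) := by
    filter_upwards [hc] with m hm
    have := h'.le_add m (g m)
    have := (hm (g m)).2 rfl
    simp only [Pi.zero_apply]
    linarith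
  have hgap0' : 0 ≤ᵐ[μ] fun m => (u m + v (g' m)) - (u' m + v' (g' m)) := by
    filter_upwards [hc'] with m hm
    have := h.le_add m (g' m)
    have := (hm (g' m)).2 rfl
    simp only [Pi.zero_apply]
    linarith
  have j1 : Integrable (fun m => u m + v (g m)) μ := i1.add i3
  have j2 : Integrable (fun m => u' m + v' (g m)) μ := i2.add i4
  have j3 : Integrable (fun m => u m + v (g' m)) μ := i1.add i5
  have j4 : Integrable (fun m => u' m + v' (g' m)) μ := i2.add i6
  have hint : ∫ m, ((u' m + v' (g m)) - (u m + v (g m))) ∂μ = 0 := by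
    have e1 := integral_nonneg_of_ae hgap0
    have e2 := integral_nonneg_of_ae hgap0'
    rw [integral_sub j2 j1, integral_add i2 i4, integral_add i1 i3] at e1 ⊢
    rw [integral_sub j3 j4, integral_add i1 i5, integral_add i2 i6] at e2
    have e3 := hpush h.continuous_right
    have e4 := hpush h'.continuous_right
    linarith
  have hzero := (integral_eq_zero_iff_of_nonneg_ae hgap0 (j2.sub j1)).1 hint
  filter_upwards [hzero, hc, hc'] with m hm hmc hmc'
  refine (hmc' (g m)).1 ?_
  have := (hmc (g m)).2 rfl
  simp only [Pi.zero_apply] at hm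
  linarith

end Transport

/-! ### Almost everywhere uniqueness of the maximiser -/

section Cone

open scoped Pointwise

variable {E : Type*} [NormedAddCommGroup E] [InnerProductSpace ℝ E]

lemma hasFDerivAt_norm_of_norm_eq_one {m : E} (hm : ‖m‖ = 1) :
    HasFDerivAt (fun p : E => ‖p‖) (innerSL ℝ m) m := by
  have h := (hasStrictFDerivAt_norm_sq m).hasFDerivAt.sqrt (by simp [hm])
  simp only [Real.sqrt_sq (norm_nonneg _), hm] at h
  convert h using 1
  ext v
  simp

/-- Rademacher's theorem on the unit sphere, for positively homogeneous functions. -/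
theorem ae_toSphere_differentiableAt [FiniteDimensional ℝ E] [MeasurableSpace E] [BorelSpace E]
    {S : E → ℝ} {C : NNReal} (hS : LipschitzWith C S)
    (hhom : ∀ t : ℝ, 0 < t → ∀ p, S (t • p) = t * S p) :
    ∀ᵐ m : Metric.sphere (0 : E) 1 ∂(volume : Measure E).toSphere, DifferentiableAt ℝ S m := by
  have hmeas : MeasurableSet {m : Metric.sphere (0 : E) 1 | DifferentiableAt ℝ S m}ᶜ :=
    (measurable_subtype_coe (measurableSet_of_differentiableAt ℝ S)).compl
  have hae : volume {p : E | ¬ DifferentiableAt ℝ S p} = 0 :=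
    hS.ae_differentiableAt (μ := volume)
  -- The set of points without derivative is a cone, and its base is null if the cone is.
  change (volume : Measure E).toSphere {m : Metric.sphere (0 : E) 1 | DifferentiableAt ℝ S m}ᶜ = 0
  rw [Measure.toSphere_apply' _ hmeas, measure_mono_null _ hae, mul_zero]
  rintro p ⟨t, ht, _, ⟨m, hm, rfl⟩, rfl⟩ hdiff
  refine hm ?_
  have h1 : DifferentiableAt ℝ (fun q : E => S (t • q)) (m : E) :=
    DifferentiableAt.comp (m : E) hdiff (differentiableAt_id.const_smul t)
  have h2 : S = fun q => t⁻¹ * S (t • q) := by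
    funext q
    rw [hhom t ht.1, inv_mul_cancel_left₀ ht.1.ne']
  change DifferentiableAt ℝ S m
  rw [h2]
  exact h1.const_mul _

/-- For almost every direction `m`, all indices maximising `a y + ⟪b y, m⟫` give the same gradient
`a y • m + b y` of `p ↦ a y * ‖p‖ + ⟪b y, p⟫`: the supremum of these functions is Lipschitz and
positively homogeneous, and at a point of differentiability its gradient is that of each active
function. -/
theorem ae_toSphere_gradient_eq [FiniteDimensional ℝ E] [MeasurableSpace E] [BorelSpace E]
    {A : Type*} [TopologicalSpace A] [CompactSpace A] {a : A → ℝ} {b : A → E}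
    (ha : Continuous a) (hb : Continuous b) :
    ∀ᵐ m : Metric.sphere (0 : E) 1 ∂(volume : Measure E).toSphere, ∀ x x' : A,
      (∀ y, a y + inner ℝ (b y) (m : E) ≤ a x + inner ℝ (b x) (m : E)) →
      (∀ y, a y + inner ℝ (b y) (m : E) ≤ a x' + inner ℝ (b x') (m : E)) →
      a x • (m : E) + b x = a x' • (m : E) + b x' := by
  rcases isEmpty_or_nonempty A with hA | hA
  · exact Eventually.of_forall fun m x => (hA.false x).elim
  let f : A → E → ℝ := fun y p => a y * ‖p‖ + inner ℝ (b y) p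
  let S : E → ℝ := fun p => ⨆ y, f y p
  obtain ⟨Ca, hCa⟩ := (isCompact_range ha.norm).bddAbove
  obtain ⟨Cb, hCb⟩ := (isCompact_range hb.norm).bddAbove
  have hbdd : ∀ p, BddAbove (range fun y => f y p) := fun p =>
    (isCompact_range ((ha.mul continuous_const).add (hb.inner continuous_const))).bddAbove
  have hle : ∀ y p, f y p ≤ S p := fun y p => le_ciSup (hbdd p) y
  have hCa0 : 0 ≤ Ca := (norm_nonneg _).trans (hCa (mem_range_self hA.some))
  have hCb0 : 0 ≤ Cb := (norm_nonneg _).trans (hCb (mem_range_self hA.some))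
  have hlip : LipschitzWith (Ca + Cb).toNNReal S := by
    refine LipschitzWith.of_le_add_mul _ fun p q => ciSup_le fun y => ?_
    rw [Real.coe_toNNReal _ (by positivity), dist_eq_norm]
    have h1 : a y * (‖p‖ - ‖q‖) ≤ Ca * ‖p - q‖ :=
      (le_abs_self _).trans ((abs_mul _ _).trans_le (mul_le_mul (hCa (mem_range_self y))
        (abs_norm_sub_norm_le p q) (abs_nonneg _) hCa0))
    have h2 : inner ℝ (b y) (p - q) ≤ Cb * ‖p - q‖ :=
      (real_inner_le_norm _ _).trans
        (mul_le_mul_of_nonneg_right (hCb (mem_range_self y)) (norm_nonneg _))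
    rw [inner_sub_right] at h2
    have h3 := hle y q
    simp only [f] at h3 ⊢
    linarith
  have hhom : ∀ t : ℝ, 0 < t → ∀ p, S (t • p) = t * S p := fun t ht p => by
    change ⨆ y, f y (t • p) = t * ⨆ y, f y p
    rw [Real.mul_iSup_of_nonneg ht.le]
    congr 1
    funext y
    simp only [f, norm_smul, inner_smul_right, Real.norm_of_nonneg ht.le]
    ring
  filter_upwards [ae_toSphere_differentiableAt hlip hhom] with m hm
  have hm1 : ‖(m : E)‖ = 1 := by simp
  have key : ∀ x, (∀ y, a y + inner ℝ (b y) (m : E) ≤ a x + inner ℝ (b x) (m : E)) →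
      fderiv ℝ S m = innerSL ℝ (a x • (m : E) + b x) := by
    intro x hx
    have hfx : HasFDerivAt (f x) (innerSL ℝ (a x • (m : E) + b x)) (m : E) := by
      rw [map_add, map_smul]
      exact ((hasFDerivAt_norm_of_norm_eq_one hm1).const_mul (a x)).add
        (innerSL ℝ (b x)).hasFDerivAt
    have hSx : S m ≤ f x m := ciSup_le fun y => by simpa [f, hm1] using hx y
    -- `S - f x` is nonnegative and vanishes at `m`.
    have hmin : IsLocalMin (fun p => S p - f x p) (m : E) :=
      Eventually.of_forall fun p => by linarith [hle x p]
    have := hmin.hasFDerivAt_eq_zero (hm.hasFDerivAt.sub hfx)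
    exact sub_eq_zero.1 this
  intro x x' hx hx'
  exact (innerSL_inj (𝕜 := ℝ)).1 ((key x hx).symm.trans (key x' hx'))

end Cone

section Twist

/-- Injectivity of inversion: `α q` and `α |q|²` determine the factor `α` if `q ≠ 0`. -/
lemma eq_of_mul_eq_of_mul_sq_eq {α α' q₁ q₂ q₁' q₂' : ℝ} (hα : 0 < α)
    (hq : q₁ ^ 2 + q₂ ^ 2 ≠ 0) (h₁ : α * q₁ = α' * q₁') (h₂ : α * q₂ = α' * q₂')
    (h₃ : α * (q₁ ^ 2 + q₂ ^ 2) = α' * (q₁' ^ 2 + q₂' ^ 2)) : α = α' := by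
  have h : (α * (q₁ ^ 2 + q₂ ^ 2)) * (α - α') = 0 := by
    linear_combination (α * q₁ + α' * q₁') * h₁ + (α * q₂ + α' * q₂') * h₂ - α' * h₃
  rcases mul_eq_zero.1 h with h | h
  · exact absurd h (mul_ne_zero hα.ne' hq)
  · linarith

lemma inner_horiz (m : Sphere2) (x : Plane) :
    inner ℝ (horiz m) x = m.1 0 * x 0 + m.1 1 * x 1 := by
  simp [horiz, PiLp.inner_apply, Fin.sum_univ_two, mul_comm]

lemma plane_norm_sq (x : Plane) : ‖x‖ ^ 2 = x 0 ^ 2 + x 1 ^ 2 := by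
  simp [EuclideanSpace.norm_sq_eq, Fin.sum_univ_two]

lemma sphere_sq (m : Sphere2) : m.1 0 ^ 2 + m.1 1 ^ 2 + vert m ^ 2 = 1 := by
  have h := EuclideanSpace.norm_sq_eq (m : EuclideanSpace ℝ (Fin 3))
  rw [norm_eq_of_mem_sphere] at h
  simpa [Fin.sum_univ_three, vert, eq_comm] using h

/-- In terms of the stereographic projection `y = m_x / (1 + m_z)`, the kernel is
`K(m, x) = δ² |x - ℓ y|² / (ℓ² - |x|²)`. -/
lemma kernelK_eq {ℓ : ℝ} (hℓ : 0 < ℓ) {m : Sphere2} (hm : 0 < 1 + vert m) {x : Plane}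
    (hx : ‖x‖ < ℓ) :
    kernelK ℓ m x = delta ℓ ^ 2 * ((x 0 - ℓ * (m.1 0 / (1 + vert m))) ^ 2 +
      (x 1 - ℓ * (m.1 1 / (1 + vert m))) ^ 2) / (ℓ ^ 2 - ‖x‖ ^ 2) := by
  have h1 : ℓ ^ 2 - ‖x‖ ^ 2 ≠ 0 := by nlinarith [norm_nonneg x]
  have hs := sphere_sq m
  have hn := plane_norm_sq x
  rw [kernelK, inner_horiz, delta]
  rw [div_mul_eq_div_div]
  field_simp
  rw [hn]
  linear_combination (-ℓ ^ 2) * hs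

/-- The gradient in `m` determines the target point: equality of the gradients of
`p ↦ (α (ℓ |p| - ⟨p_x, x⟩) - β (|p| + p_z))` at `m`, where `β = α (ℓ² - |x|²) / (2 ℓ)`,
forces equality of the target points. -/
lemma eq_of_gradient_eq {ℓ : ℝ} (hℓ : 0 < ℓ) {m : Sphere2} (hm : 0 < 1 + vert m) {x x' : Plane}
    (hx : ‖x‖ < ℓ) (hK : 0 < kernelK ℓ m x) {α α' β β' : ℝ} (hα : 0 < α)
    (hβ : 2 * ℓ * β = α * (ℓ ^ 2 - ‖x‖ ^ 2)) (hβ' : 2 * ℓ * β' = α' * (ℓ ^ 2 - ‖x'‖ ^ 2))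
    (h₀ : (ℓ * α - β) * m.1 0 - α * x 0 = (ℓ * α' - β') * m.1 0 - α' * x' 0)
    (h₁ : (ℓ * α - β) * m.1 1 - α * x 1 = (ℓ * α' - β') * m.1 1 - α' * x' 1)
    (h₂ : (ℓ * α - β) * vert m - β = (ℓ * α' - β') * vert m - β') : x = x' := by
  rw [kernelK_eq hℓ hm hx] at hK
  have hs := sphere_sq m
  rw [plane_norm_sq] at hβ hβ'
  -- In the stereographic coordinates `y`, the three equations say that `α q` and `α |q|²` agree for
  -- `q = x - ℓ y`; positivity of the kernel means `q ≠ 0`.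
  obtain ⟨y₀, hy₀⟩ : ∃ y₀, y₀ = m.1 0 / (1 + vert m) := ⟨_, rfl⟩
  obtain ⟨y₁, hy₁⟩ : ∃ y₁, y₁ = m.1 1 / (1 + vert m) := ⟨_, rfl⟩
  rw [← hy₀, ← hy₁] at hK
  rw [eq_div_iff hm.ne'] at hy₀ hy₁
  rw [← hy₀] at hs h₀
  rw [← hy₁] at hs h₁
  have hs' : (y₀ ^ 2 + y₁ ^ 2) * (1 + vert m) = 1 - vert m := by
    have : (1 + vert m) * ((y₀ ^ 2 + y₁ ^ 2) * (1 + vert m) - (1 - vert m)) = 0 := by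
      linear_combination hs
    have := (mul_eq_zero.1 this).resolve_left hm.ne'
    linarith
  have e₀ : α * (x 0 - ℓ * y₀) = α' * (x' 0 - ℓ * y₀) := by
    linear_combination y₀ * h₂ - h₀
  have e₁ : α * (x 1 - ℓ * y₁) = α' * (x' 1 - ℓ * y₁) := by
    linear_combination y₁ * h₂ - h₁
  have hββ : 2 * (β - β') = ℓ * (α - α') * (1 - y₀ ^ 2 - y₁ ^ 2) := by
    have : (1 + vert m) * (2 * (β - β') - ℓ * (α - α') * (1 - y₀ ^ 2 - y₁ ^ 2)) = 0 := by
      linear_combination ℓ * (α - α') * hs' - 2 * h₂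
    have := (mul_eq_zero.1 this).resolve_left hm.ne'
    linarith
  have e₂ : α * ((x 0 - ℓ * y₀) ^ 2 + (x 1 - ℓ * y₁) ^ 2) =
      α' * ((x' 0 - ℓ * y₀) ^ 2 + (x' 1 - ℓ * y₁) ^ 2) := by
    linear_combination (-2 * ℓ * y₀) * e₀ - 2 * ℓ * y₁ * e₁ + hβ - hβ' - ℓ * hββ
  have hq : (x 0 - ℓ * y₀) ^ 2 + (x 1 - ℓ * y₁) ^ 2 ≠ 0 := by
    intro h
    rw [h] at hK
    simp at hK
  obtain rfl := eq_of_mul_eq_of_mul_sq_eq hα hq e₀ e₁ e₂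
  have f₀ := mul_left_cancel₀ hα.ne' e₀
  have f₁ := mul_left_cancel₀ hα.ne' e₁
  ext i
  fin_cases i
  · simpa using f₀
  · simpa using f₁

/-- For almost every direction `m`, the ratio `K(m, ·) / ζ` has at most one maximum point. -/
theorem ae_maximizer_unique {ℓ : ℝ} (hℓ : 0 < ℓ) {A : Set Plane} (hA : IsCompact A)
    (hAℓ : ∀ x ∈ A, ‖x‖ < ℓ) {ζ : Plane → ℝ} (hζ : ContinuousOn ζ A) (hζ0 : ∀ x ∈ A, 0 < ζ x) :
    ∀ᵐ m ∂surfaceMeasure, 0 < 1 + vert m → (∀ x ∈ A, 0 < kernelK ℓ m x) → ∀ x ∈ A, ∀ x' ∈ A,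
      (∀ y ∈ A, 1 / ζ y * kernelK ℓ m y ≤ 1 / ζ x * kernelK ℓ m x) →
      (∀ y ∈ A, 1 / ζ y * kernelK ℓ m y ≤ 1 / ζ x' * kernelK ℓ m x') → x = x' := by
  have : CompactSpace A := isCompact_iff_compactSpace.1 hA
  have hden : ∀ x ∈ A, 0 < ℓ ^ 2 - ‖x‖ ^ 2 := fun x hx => by
    nlinarith [norm_nonneg x, hAℓ x hx]
  have hζc : Continuous fun x : A => ζ x := continuousOn_iff_continuous_domRestrict.1 hζ
  let α : A → ℝ := fun x => delta ℓ / ((ℓ ^ 2 - ‖(x : Plane)‖ ^ 2) * ζ x)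
  let β : A → ℝ := fun x => delta ℓ ^ 2 / ζ x
  have hα : Continuous α := continuous_const.div
    ((continuous_const.sub (continuous_subtype_val.norm.pow 2)).mul hζc)
    fun x => (mul_pos (hden x x.2) (hζ0 x x.2)).ne'
  have hβ : Continuous β := continuous_const.div hζc fun x => (hζ0 x x.2).ne'
  let a : A → ℝ := fun x => ℓ * α x - β x
  let b : A → EuclideanSpace ℝ (Fin 3) := fun x => !₂[-(α x * x.1 0), -(α x * x.1 1), -β x]
  have ha : Continuous a := by fun_prop
  have hb : Continuous b := by
    refine (PiLp.continuous_toLp 2 _).comp (continuous_pi fun i => ?_)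
    fin_cases i
    · simp; fun_prop
    · simp; fun_prop
    · simp; fun_prop
  filter_upwards [ae_toSphere_gradient_eq ha hb] with m hgrad hm hK x hx x' hx' hmax hmax'
  -- Up to the factor `1 + m_z`, the ratio is `a + ⟪b, m⟫`.
  have hval : ∀ y : A, a y + inner ℝ (b y) (m : EuclideanSpace ℝ (Fin 3)) =
      (1 + vert m) * (1 / ζ y * kernelK ℓ m y) := fun y => by
    have h1 := (hden y y.2).ne'
    have h2 := (hζ0 y y.2).ne'
    simp only [a, b, α, β, kernelK, inner_horiz]
    simp [PiLp.inner_apply, Fin.sum_univ_three]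
    change _ = (1 + m.1 2) * _
    have h3 : (1 + m.1 2) ≠ 0 := hm.ne'
    simp only [vert]
    field_simp
    ring
  have hmul : ∀ {r s : ℝ}, r ≤ s → (1 + vert m) * r ≤ (1 + vert m) * s := fun h =>
    mul_le_mul_of_nonneg_left h hm.le
  have hg := hgrad ⟨x, hx⟩ ⟨x', hx'⟩
    (fun y => by rw [hval, hval]; exact hmul (hmax y y.2))
    (fun y => by rw [hval, hval]; exact hmul (hmax' y y.2))
  have hαβ : ∀ y : A, 2 * ℓ * β y = α y * (ℓ ^ 2 - ‖(y : Plane)‖ ^ 2) := fun y => by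
    have h1 := (hden y y.2).ne'
    have h2 := (hζ0 y y.2).ne'
    simp only [α, β, delta]
    field_simp
  refine eq_of_gradient_eq (α := α ⟨x, hx⟩) (α' := α ⟨x', hx'⟩) (β := β ⟨x, hx⟩)
    (β' := β ⟨x', hx'⟩) hℓ hm (hAℓ x hx) (hK x hx) ?_ (hαβ ⟨x, hx⟩) (hαβ ⟨x', hx'⟩) ?_ ?_ ?_
  · have := hden x hx
    have := hζ0 x hx
    simp only [α, delta]
    positivity
  · simpa [a, b, sub_eq_add_neg] using congrArg (fun p => p 0) hg
  · simpa [a, b, sub_eq_add_neg] using congrArg (fun p => p 1) hg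
  · simpa [a, b, sub_eq_add_neg, vert] using congrArg (fun p => p 2) hg

end Twist

/-! ### Lipschitz estimates -/

section LipschitzTools

variable {α : Type*} [PseudoMetricSpace α] {s : Set α}

/-- A `C¹` function of a Lipschitz function on a compact set is Lipschitz there. -/
lemma exists_lipschitzOnWith_comp {F G : Type*} [NormedAddCommGroup F] [NormedSpace ℝ F]
    [NormedAddCommGroup G] [NormedSpace ℝ G] {f : α → F} {Ψ : F → G} (hs : IsCompact s)
    (hf : ∃ C : NNReal, LipschitzOnWith C f s) (hΨ : ∀ a ∈ s, ContDiffAt ℝ 1 Ψ (f a)) :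
    ∃ C : NNReal, LipschitzOnWith C (fun a => Ψ (f a)) s := by
  obtain ⟨C, hC⟩ := hf
  have hloc : LocallyLipschitzOn (f '' s) Ψ := by
    rintro _ ⟨a, ha, rfl⟩
    obtain ⟨K, t, ht, hK⟩ := (hΨ a ha).exists_lipschitzOnWith
    exact ⟨K, t, mem_nhdsWithin_of_mem_nhds ht, hK⟩
  obtain ⟨K, hK⟩ :=
    hloc.exists_lipschitzOnWith_of_compact (hs.image_of_continuousOn hC.continuousOn)
  exact ⟨K * C, hK.comp hC (mapsTo_image f s)⟩

lemma exists_lipschitzOnWith_prodMk {β γ : Type*} [PseudoMetricSpace β] [PseudoMetricSpace γ]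
    {f : α → β} {g : α → γ} (hf : ∃ C : NNReal, LipschitzOnWith C f s)
    (hg : ∃ C : NNReal, LipschitzOnWith C g s) :
    ∃ C : NNReal, LipschitzOnWith C (fun a => (f a, g a)) s := by
  obtain ⟨C, hC⟩ := hf
  obtain ⟨C', hC'⟩ := hg
  exact ⟨max C C', hC.prodMk hC'⟩

/-- A supremum of functions with a common Lipschitz constant has this Lipschitz constant. -/
lemma lipschitzOnWith_of_isLUB {ι : Type*} {t : Set ι} {C : NNReal} {f : α → ι → ℝ} {g : α → ℝ}
    (hf : ∀ i ∈ t, LipschitzOnWith C (fun a => f a i) s)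
    (hg : ∀ a ∈ s, IsLUB (f a '' t) (g a)) : LipschitzOnWith C g s := by
  refine LipschitzOnWith.of_le_add_mul C fun a ha b hb => (hg a ha).2 ?_
  rintro _ ⟨i, hi, rfl⟩
  have h1 := (hg b hb).1 (mem_image_of_mem _ hi)
  have h2 := (hf i hi).dist_le_mul a ha b hb
  rw [Real.dist_eq] at h2
  linarith [(abs_le.1 h2).2]

end LipschitzTools

/-- The geometric hypotheses on the aperture `D` and the target `T`. -/
structure Admissible (ℓ : ℝ) (D : Set Sphere2) (T : Set Plane) : Prop where
  pos : 0 < ℓ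
  isCompact_right : IsCompact (closure T)
  nonempty_left : D.Nonempty
  nonempty_right : T.Nonempty
  vert_pos : ∀ m ∈ closure D, 0 < 1 + vert m
  norm_lt : ∀ x ∈ closure T, ‖x‖ < ℓ
  kernelK_pos : ∀ m ∈ closure D, ∀ x ∈ closure T, 0 < kernelK ℓ m x

lemma one_add_vert_pos {m : Sphere2} (hm : m.1 ≠ !₂[(0 : ℝ), 0, -1]) : 0 < 1 + vert m := by
  have hs := sphere_sq m
  by_contra! h
  have hv : vert m = -1 := by nlinarith [sq_nonneg (m.1 0), sq_nonneg (m.1 1)]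
  rw [hv] at hs
  have h0 : m.1 0 = 0 := by nlinarith [sq_nonneg (m.1 0), sq_nonneg (m.1 1)]
  have h1 : m.1 1 = 0 := by nlinarith [sq_nonneg (m.1 0), sq_nonneg (m.1 1)]
  refine hm ?_
  ext i
  fin_cases i
  · simpa using h0
  · simpa using h1
  · simpa [vert] using hv

/-- The transport cost `log K`, to be maximised, on `closure D × closure T`. -/
noncomputable def logK (ℓ : ℝ) (D : Set Sphere2) (T : Set Plane) (m : closure D) (x : closure T) :
    ℝ :=
  Real.log (kernelK ℓ m x)

namespace Admissible

variable {ℓ : ℝ} {D : Set Sphere2} {T : Set Plane}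

lemma isCompact_left (_h : Admissible ℓ D T) : IsCompact (closure D) :=
  isClosed_closure.isCompact

lemma delta_pos (h : Admissible ℓ D T) : 0 < delta ℓ := by
  have := h.pos
  unfold delta
  positivity

lemma sq_sub_pos (h : Admissible ℓ D T) {x : Plane} (hx : x ∈ closure T) :
    0 < ℓ ^ 2 - ‖x‖ ^ 2 := by
  nlinarith [norm_nonneg x, h.norm_lt x hx]

lemma exists_lipschitzOnWith_kernelK (h : Admissible ℓ D T) :
    ∃ C : NNReal, LipschitzOnWith C (fun p : Sphere2 × Plane => kernelK ℓ p.1 p.2)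
      (closure D ×ˢ closure T) := by
  let Ψ : EuclideanSpace ℝ (Fin 3) × Plane → ℝ := fun p =>
    delta ℓ * ((ℓ - (p.1 0 * p.2 0 + p.1 1 * p.2 1)) / ((ℓ ^ 2 - ‖p.2‖ ^ 2) * (1 + p.1 2)))
      - delta ℓ ^ 2
  have hΨ : ∀ p : Sphere2 × Plane, kernelK ℓ p.1 p.2 = Ψ (p.1, p.2) := fun p => by
    simp only [kernelK, inner_horiz, vert, Ψ]
  simp only [hΨ]
  refine exists_lipschitzOnWith_comp (f := fun p : Sphere2 × Plane =>
    ((p.1 : EuclideanSpace ℝ (Fin 3)), p.2)) (h.isCompact_left.prod h.isCompact_right) ?_ ?_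
  · exact exists_lipschitzOnWith_prodMk
      ⟨1 * 1, ((LipschitzWith.subtype_val _).comp LipschitzWith.prod_fst).lipschitzOnWith⟩
      ⟨1, LipschitzWith.prod_snd.lipschitzOnWith⟩
  · rintro ⟨m, x⟩ ⟨hm, hx⟩
    have h1 : (ℓ ^ 2 - ‖x‖ ^ 2) * (1 + m.1 2) ≠ 0 :=
      (mul_pos (h.sq_sub_pos hx) (h.vert_pos m hm)).ne'
    have hfst : ∀ i, ContDiff ℝ 1 fun p : EuclideanSpace ℝ (Fin 3) × Plane => p.1 i := fun i =>
      (EuclideanSpace.proj (𝕜 := ℝ) i).contDiff.comp contDiff_fst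
    have hsnd : ∀ i, ContDiff ℝ 1 fun p : EuclideanSpace ℝ (Fin 3) × Plane => p.2 i := fun i =>
      (EuclideanSpace.proj (𝕜 := ℝ) i).contDiff.comp contDiff_snd
    have hnum : ContDiff ℝ 1 fun p : EuclideanSpace ℝ (Fin 3) × Plane =>
        ℓ - (p.1 0 * p.2 0 + p.1 1 * p.2 1) :=
      contDiff_const.sub (((hfst 0).mul (hsnd 0)).add ((hfst 1).mul (hsnd 1)))
    have hden : ContDiff ℝ 1 fun p : EuclideanSpace ℝ (Fin 3) × Plane =>
        (ℓ ^ 2 - ‖p.2‖ ^ 2) * (1 + p.1 2) :=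
      (contDiff_const.sub (contDiff_snd.norm_sq ℝ)).mul (contDiff_const.add (hfst 2))
    have hquot : ContDiffAt ℝ 1 (fun p : EuclideanSpace ℝ (Fin 3) × Plane =>
        (ℓ - (p.1 0 * p.2 0 + p.1 1 * p.2 1)) / ((ℓ ^ 2 - ‖p.2‖ ^ 2) * (1 + p.1 2)))
        ((m : EuclideanSpace ℝ (Fin 3)), x) := by
      refine ContDiffAt.div ?_ ?_ h1
      · exact hnum.contDiffAt
      · exact hden.contDiffAt
    refine ContDiffAt.sub ?_ contDiffAt_const
    exact contDiffAt_const.mul hquot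

lemma continuousOn_kernelK (h : Admissible ℓ D T) :
    ContinuousOn (fun p : Sphere2 × Plane => kernelK ℓ p.1 p.2) (closure D ×ˢ closure T) :=
  h.exists_lipschitzOnWith_kernelK.choose_spec.continuousOn

lemma continuous_logK (h : Admissible ℓ D T) : Continuous (Function.uncurry (logK ℓ D T)) := by
  refine Continuous.log ?_ fun p => (h.kernelK_pos _ p.1.2 _ p.2.2).ne'
  exact h.continuousOn_kernelK.comp_continuous (f := fun p : closure D × closure T =>
    ((p.1 : Sphere2), (p.2 : Plane))) (by fun_prop) fun p => ⟨p.1.2, p.2.2⟩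

lemma exists_lipschitzWith_logK (h : Admissible ℓ D T) :
    ∃ C : NNReal, ∀ m, LipschitzWith C (logK ℓ D T m) := by
  obtain ⟨C, hC⟩ := exists_lipschitzOnWith_comp (Ψ := Real.log)
    (h.isCompact_left.prod h.isCompact_right) h.exists_lipschitzOnWith_kernelK
    fun p hp => Real.contDiffAt_log.2 (h.kernelK_pos _ hp.1 _ hp.2).ne'
  refine ⟨C, fun m => LipschitzWith.of_dist_le_mul fun x y => ?_⟩
  refine (hC.dist_le_mul (m, x) ⟨m.2, x.2⟩ (m, y) ⟨m.2, y.2⟩).trans_eq ?_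
  simp [Prod.dist_eq, Subtype.dist_eq]

end Admissible

namespace IsReflectorPair

variable {ℓ : ℝ} {D : Set Sphere2} {T : Set Plane} {ρ : Sphere2 → ℝ} {z : Plane → ℝ}

lemma continuousOn_rhoHat (hR : IsReflectorPair ℓ D T ρ z) (h : Admissible ℓ D T) :
    ContinuousOn (rhoHat ℓ ρ) (closure D) := by
  have hv : Continuous vert := (EuclideanSpace.proj (𝕜 := ℝ) (2 : Fin 3)).continuous.comp
    continuous_subtype_val
  refine continuousOn_const.add (continuousOn_const.div ((continuousOn_const.mul
    hR.continuousOn_rho).mul (hv.continuousOn.add continuousOn_const)) fun m hm => ?_)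
  have h1 := hR.rho_pos m hm
  have h2 := h.vert_pos m hm
  have : 0 < 2 * ρ m * (vert m + 1) := mul_pos (by positivity) (by linarith)
  exact this.ne'

lemma continuousOn_zTilde (hR : IsReflectorPair ℓ D T ρ z) (h : Admissible ℓ D T) :
    ContinuousOn (zTilde ℓ z) (closure T) :=
  continuousOn_const.sub (hR.continuousOn_z.div (by fun_prop) fun x hx => (h.sq_sub_pos hx).ne')

lemma rhoHat_lipschitz (hR : IsReflectorPair ℓ D T ρ z) (h : Admissible ℓ D T) :
    ∃ C : NNReal, LipschitzOnWith C (rhoHat ℓ ρ) (closure D) := by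
  obtain ⟨C, hC⟩ := h.exists_lipschitzOnWith_kernelK
  obtain ⟨M, hM⟩ := h.isCompact_right.bddAbove_image (f := fun x => ‖1 / zTilde ℓ z x‖)
    (continuousOn_const.div (hR.continuousOn_zTilde h) fun x hx => (hR.zTilde_pos x hx).ne').norm
  refine ⟨M.toNNReal * C, lipschitzOnWith_of_isLUB (fun x hx => ?_) hR.rhoHat_sup⟩
  refine LipschitzOnWith.of_dist_le_mul fun m hm m' hm' => ?_
  have h1 := hC.dist_le_mul (m, x) ⟨hm, hx⟩ (m', x) ⟨hm', hx⟩
  have h2 : ‖1 / zTilde ℓ z x‖ ≤ M.toNNReal :=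
    (hM (mem_image_of_mem _ hx)).trans (Real.le_coe_toNNReal M)
  rw [Prod.dist_eq, dist_self, max_eq_left dist_nonneg] at h1
  rw [dist_eq_norm, ← mul_sub, norm_mul, NNReal.coe_mul, mul_assoc]
  exact mul_le_mul h2 h1 (norm_nonneg _) (by positivity)

lemma zTilde_lipschitz (hR : IsReflectorPair ℓ D T ρ z) (h : Admissible ℓ D T) :
    ∃ C : NNReal, LipschitzOnWith C (zTilde ℓ z) (closure T) := by
  obtain ⟨C, hC⟩ := h.exists_lipschitzOnWith_kernelK
  obtain ⟨M, hM⟩ := h.isCompact_left.bddAbove_image (f := fun m => ‖1 / rhoHat ℓ ρ m‖)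
    (continuousOn_const.div (hR.continuousOn_rhoHat h) fun m hm => (hR.rhoHat_pos m hm).ne').norm
  refine ⟨M.toNNReal * C, lipschitzOnWith_of_isLUB
    (f := fun x m => 1 / rhoHat ℓ ρ m * kernelK ℓ m x) (fun m hm => ?_) hR.zTilde_sup⟩
  refine LipschitzOnWith.of_dist_le_mul fun x hx x' hx' => ?_
  have h1 := hC.dist_le_mul (m, x) ⟨hm, hx⟩ (m, x') ⟨hm, hx'⟩
  have h2 : ‖1 / rhoHat ℓ ρ m‖ ≤ M.toNNReal :=
    (hM (mem_image_of_mem _ hm)).trans (Real.le_coe_toNNReal M)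
  rw [Prod.dist_eq, dist_self, max_eq_right dist_nonneg] at h1
  rw [dist_eq_norm, ← mul_sub, norm_mul, NNReal.coe_mul, mul_assoc]
  exact mul_le_mul h2 h1 (norm_nonneg _) (by positivity)

theorem rho_lipschitz (hR : IsReflectorPair ℓ D T ρ z) (h : Admissible ℓ D T) :
    ∃ C : NNReal, LipschitzOnWith C ρ (closure D) := by
  have hδ := h.delta_pos
  obtain ⟨C, hC⟩ := exists_lipschitzOnWith_comp (f := fun m : Sphere2 => (m.1, rhoHat ℓ ρ m))
    (Ψ := fun p : EuclideanSpace ℝ (Fin 3) × ℝ => 1 / (2 * (p.1 2 + 1) * (p.2 + delta ℓ)))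
    h.isCompact_left
    (exists_lipschitzOnWith_prodMk ⟨1, (LipschitzWith.subtype_val _).lipschitzOnWith⟩
      (hR.rhoHat_lipschitz h)) fun m hm => by
    have h1 := h.vert_pos m hm
    have h2 := hR.rhoHat_pos m hm
    have h3 : 0 < 2 * (vert m + 1) * (rhoHat ℓ ρ m + delta ℓ) :=
      mul_pos (by linarith) (by linarith)
    have hfst : ContDiff ℝ 1 fun p : EuclideanSpace ℝ (Fin 3) × ℝ => p.1 2 :=
      (EuclideanSpace.proj (𝕜 := ℝ) (2 : Fin 3)).contDiff.comp contDiff_fst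
    have hden : ContDiff ℝ 1 fun p : EuclideanSpace ℝ (Fin 3) × ℝ =>
        2 * (p.1 2 + 1) * (p.2 + delta ℓ) :=
      (contDiff_const.mul (hfst.add contDiff_const)).mul (contDiff_snd.add contDiff_const)
    exact contDiffAt_const.div hden.contDiffAt h3.ne'
  have heq : ∀ m ∈ closure D, ρ m = 1 / (2 * (m.1 2 + 1) * (rhoHat ℓ ρ m + delta ℓ)) := by
    intro m hm
    have h1 := h.vert_pos m hm
    have h2 := hR.rho_pos m hm
    have h3 : vert m + 1 ≠ 0 := by linarith
    simp only [rhoHat]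
    change _ = 1 / (2 * (vert m + 1) * _)
    field_simp
    ring
  refine ⟨C, fun m hm m' hm' => ?_⟩
  rw [heq m hm, heq m' hm']
  exact hC hm hm'

theorem z_lipschitz (hR : IsReflectorPair ℓ D T ρ z) (h : Admissible ℓ D T) :
    ∃ C : NNReal, LipschitzOnWith C z (closure T) := by
  obtain ⟨C, hC⟩ := exists_lipschitzOnWith_comp (f := fun x : Plane => (x, zTilde ℓ z x))
    (Ψ := fun p : Plane × ℝ => (delta ℓ - p.2) * (ℓ ^ 2 - ‖p.1‖ ^ 2)) h.isCompact_right
    (exists_lipschitzOnWith_prodMk ⟨1, LipschitzWith.id.lipschitzOnWith⟩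
      (hR.zTilde_lipschitz h)) fun x _ =>
    ((contDiff_const.sub contDiff_snd).mul
      (contDiff_const.sub (contDiff_fst.norm_sq ℝ))).contDiffAt
  have heq : ∀ x ∈ closure T, z x = (delta ℓ - zTilde ℓ z x) * (ℓ ^ 2 - ‖x‖ ^ 2) := by
    intro x hx
    have h1 := (h.sq_sub_pos hx).ne'
    simp only [zTilde]
    field_simp
    ring
  refine ⟨C, fun x hx x' hx' => ?_⟩
  rw [heq x hx, heq x' hx']
  exact hC hx hx'

end IsReflectorPair

/-! ### Reflector pairs as conjugate potentials -/

variable {ℓ : ℝ} {D : Set Sphere2} {T : Set Plane}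

section Potentials

lemma log_eq_log_add_log_iff {K r s : ℝ} (hK : 0 < K) (hr : 0 < r) (hs : 0 < s) :
    Real.log K = Real.log r + Real.log s ↔ r = 1 / s * K := by
  rw [← Real.log_mul hr.ne' hs.ne']
  constructor
  · intro h
    have := Real.log_injOn_pos hK (mul_pos hr hs) h
    rw [this]
    field_simp
  · intro h
    rw [h]
    congr 1
    field_simp

namespace IsReflectorPair

variable {ρ : Sphere2 → ℝ} {z : Plane → ℝ}

/-- On contact pairs the logarithmic potentials add up to `log K`. -/
lemma logK_eq_iff (hR : IsReflectorPair ℓ D T ρ z) (h : Admissible ℓ D T)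
    (m : closure D) (x : closure T) :
    logK ℓ D T m x = Real.log (rhoHat ℓ ρ m) + Real.log (zTilde ℓ z x) ↔
      (x : Plane) ∈ reflectorMap ℓ T ρ z m := by
  rw [logK, log_eq_log_add_log_iff (h.kernelK_pos _ m.2 _ x.2) (hR.rhoHat_pos _ m.2)
    (hR.zTilde_pos _ x.2)]
  simp [reflectorMap, x.2]

/-- A reflector pair is a pair of conjugate potentials for the cost `log K`. -/
theorem isConjugatePair (hR : IsReflectorPair ℓ D T ρ z) (h : Admissible ℓ D T) :
    IsConjugatePair (logK ℓ D T) (fun m => Real.log (rhoHat ℓ ρ m))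
      (fun x => Real.log (zTilde ℓ z x)) := by
  have hKc := h.continuousOn_kernelK
  have hr := hR.continuousOn_rhoHat h
  have hz := hR.continuousOn_zTilde h
  refine ⟨?_, ?_, fun m x => ?_, fun m => ?_, fun x => ?_⟩
  · exact (continuousOn_iff_continuous_domRestrict.1 hr).log fun m => (hR.rhoHat_pos m m.2).ne'
  · exact (continuousOn_iff_continuous_domRestrict.1 hz).log fun x => (hR.zTilde_pos x x.2).ne'
  · have h1 := hR.rhoHat_pos m m.2
    have h2 := hR.zTilde_pos x x.2
    have h3 := (hR.rhoHat_sup m m.2).1 (mem_image_of_mem _ x.2)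
    rw [← Real.log_mul h1.ne' h2.ne', logK]
    refine Real.log_le_log (h.kernelK_pos _ m.2 _ x.2) ?_
    rwa [one_div_mul_eq_div, div_le_iff₀ h2] at h3
  · have hc : ContinuousOn (fun x => 1 / zTilde ℓ z x * kernelK ℓ m x) (closure T) :=
      (continuousOn_const.div hz fun x hx => (hR.zTilde_pos x hx).ne').mul
        (hKc.comp (f := fun x => ((m : Sphere2), x)) (by fun_prop) fun x hx => ⟨m.2, hx⟩)
    obtain ⟨x, hx, hmx⟩ := (hR.rhoHat_sup m m.2).mem_of_isClosed
      (h.nonempty_right.closure.image _) (h.isCompact_right.image_of_continuousOn hc).isClosed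
    exact ⟨⟨x, hx⟩, (hR.logK_eq_iff h m ⟨x, hx⟩).2 ⟨hx, hmx.symm⟩⟩
  · have hc : ContinuousOn (fun m => 1 / rhoHat ℓ ρ m * kernelK ℓ m x) (closure D) :=
      (continuousOn_const.div hr fun m hm => (hR.rhoHat_pos m hm).ne').mul
        (hKc.comp (f := fun m => (m, (x : Plane))) (by fun_prop) fun m hm => ⟨hm, x.2⟩)
    obtain ⟨m, hm, hmx⟩ := (hR.zTilde_sup x x.2).mem_of_isClosed
      (h.nonempty_left.closure.image _) (h.isCompact_left.image_of_continuousOn hc).isClosed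
    refine ⟨⟨m, hm⟩, ?_⟩
    rw [add_comm, logK]
    exact (log_eq_log_add_log_iff (h.kernelK_pos _ hm _ x.2) (hR.zTilde_pos _ x.2)
      (hR.rhoHat_pos _ hm)).2 hmx.symm

/-- The reflector map is single valued almost everywhere, with a measurable selection. -/
theorem exists_measurable_selection (hR : IsReflectorPair ℓ D T ρ z) (h : Admissible ℓ D T) :
    ∃ g : closure D → closure T, Measurable g ∧
      ∀ᵐ m ∂(surfaceMeasure.comap (Subtype.val : closure D → Sphere2)),
        ∀ x, logK ℓ D T m x = Real.log (rhoHat ℓ ρ m) + Real.log (zTilde ℓ z x) ↔ x = g m := by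
  have : CompactSpace (closure D) := isCompact_iff_compactSpace.1 h.isCompact_left
  have : CompactSpace (closure T) := isCompact_iff_compactSpace.1 h.isCompact_right
  refine (hR.isConjugatePair h).exists_measurable_contact h.continuous_logK ?_
  have hae := ae_maximizer_unique h.pos h.isCompact_right h.norm_lt (hR.continuousOn_zTilde h)
    hR.zTilde_pos
  have hae' := (ae_restrict_iff_subtype (μ := surfaceMeasure) (s := closure D)
    isClosed_closure.measurableSet).1 (ae_restrict_of_ae hae)
  filter_upwards [hae'] with m hm x x' hx hx'
  rw [hR.logK_eq_iff h] at hx hx'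
  have hub : ∀ y ∈ closure T, 1 / zTilde ℓ z y * kernelK ℓ m y ≤ rhoHat ℓ ρ m := fun y hy =>
    (hR.rhoHat_sup m m.2).1 (mem_image_of_mem _ hy)
  exact Subtype.ext (hm (h.vert_pos m m.2) (h.kernelK_pos m m.2) x x.2 x' x'.2
    (fun y hy => (hub y hy).trans_eq hx.2) fun y hy => (hub y hy).trans_eq hx'.2)

lemma reflectorMap_eq_singleton (hR : IsReflectorPair ℓ D T ρ z) (h : Admissible ℓ D T)
    {m : closure D} {y : closure T}
    (hm : ∀ x, logK ℓ D T m x = Real.log (rhoHat ℓ ρ m) + Real.log (zTilde ℓ z x) ↔ x = y) :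
    reflectorMap ℓ T ρ z m = {(y : Plane)} := by
  ext x
  rw [mem_singleton_iff]
  constructor
  · intro hx
    exact congrArg Subtype.val ((hm ⟨x, hx.1⟩).1 ((hR.logK_eq_iff h m ⟨x, hx.1⟩).2 hx))
  · rintro rfl
    exact (hR.logK_eq_iff h m y).1 ((hm y).2 rfl)

end IsReflectorPair

/-- Conjugate potentials for the cost `log K` come from a reflector pair. -/
theorem exists_isReflectorPair (h : Admissible ℓ D T) {u : closure D → ℝ} {v : closure T → ℝ}
    (huv : IsConjugatePair (logK ℓ D T) u v) :
    ∃ ρ z, IsReflectorPair ℓ D T ρ z ∧ (∀ m : closure D, Real.log (rhoHat ℓ ρ m) = u m) ∧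
      ∀ x : closure T, Real.log (zTilde ℓ z x) = v x := by
  have hδ := h.delta_pos
  let U : Sphere2 → ℝ := Function.extend Subtype.val u 0
  let V : Plane → ℝ := Function.extend Subtype.val v 0
  have hU : ∀ m : closure D, U m = u m := fun m => Subtype.val_injective.extend_apply _ _ _
  have hV : ∀ x : closure T, V x = v x := fun x => Subtype.val_injective.extend_apply _ _ _
  have hUc : ContinuousOn U (closure D) := by
    rw [continuousOn_iff_continuous_domRestrict]
    exact huv.continuous_left.congr fun m => (hU m).symm
  have hVc : ContinuousOn V (closure T) := by
    rw [continuousOn_iff_continuous_domRestrict]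
    exact huv.continuous_right.congr fun x => (hV x).symm
  -- The reflectors are obtained by solving `rhoHat = exp u` and `zTilde = exp v`.
  let ρ : Sphere2 → ℝ := fun m => 1 / (2 * (vert m + 1) * (Real.exp (U m) + delta ℓ))
  let z : Plane → ℝ := fun x => (delta ℓ - Real.exp (V x)) * (ℓ ^ 2 - ‖x‖ ^ 2)
  have hpos : ∀ m ∈ closure D, 0 < 2 * (vert m + 1) * (Real.exp (U m) + delta ℓ) := fun m hm =>
    mul_pos (by linarith [h.vert_pos m hm]) (add_pos (Real.exp_pos _) hδ)
  have hr : ∀ m ∈ closure D, rhoHat ℓ ρ m = Real.exp (U m) := fun m hm => by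
    have h1 : vert m + 1 ≠ 0 := by linarith [h.vert_pos m hm]
    have h2 : Real.exp (U m) + delta ℓ ≠ 0 := (add_pos (Real.exp_pos _) hδ).ne'
    simp only [rhoHat, ρ]
    field_simp
    ring
  have hz : ∀ x ∈ closure T, zTilde ℓ z x = Real.exp (V x) := fun x hx => by
    have h1 := (h.sq_sub_pos hx).ne'
    simp only [zTilde, z]
    field_simp
    ring
  have hle : ∀ m : closure D, ∀ x : closure T,
      kernelK ℓ m x ≤ Real.exp (U m) * Real.exp (V x) := fun m x => by
    rw [← Real.exp_add, hU, hV, ← Real.log_le_iff_le_exp (h.kernelK_pos m m.2 x x.2)]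
    exact huv.le_add m x
  have heq : ∀ (m : closure D) (x : closure T), logK ℓ D T m x = u m + v x →
      kernelK ℓ m x = Real.exp (U m) * Real.exp (V x) := fun m x hmx => by
    rw [← Real.exp_add, hU, hV, ← hmx, logK, Real.exp_log (h.kernelK_pos m m.2 x x.2)]
  refine ⟨ρ, z, ⟨?_, ?_, ?_, ?_, ?_, ?_, ?_⟩, fun m => ?_, fun x => ?_⟩
  · have hv : Continuous vert := (EuclideanSpace.proj (𝕜 := ℝ) (2 : Fin 3)).continuous.comp
      continuous_subtype_val
    exact continuousOn_const.div ((continuousOn_const.mul (hv.continuousOn.add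
      continuousOn_const)).mul (hUc.rexp.add continuousOn_const)) fun m hm => (hpos m hm).ne'
  · exact fun m hm => one_div_pos.2 (hpos m hm)
  · exact (continuousOn_const.sub hVc.rexp).mul (by fun_prop)
  · exact fun m hm => hr m hm ▸ Real.exp_pos _
  · exact fun x hx => hz x hx ▸ Real.exp_pos _
  · intro m hm
    rw [hr m hm]
    refine IsGreatest.isLUB ⟨?_, ?_⟩
    · obtain ⟨x, hx⟩ := huv.exists_right ⟨m, hm⟩
      refine ⟨x, x.2, ?_⟩
      dsimp only
      rw [hz x x.2, heq ⟨m, hm⟩ x hx]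
      field_simp
    · rintro _ ⟨x, hx, rfl⟩
      dsimp only
      rw [hz x hx, one_div_mul_eq_div, div_le_iff₀ (Real.exp_pos _)]
      exact hle ⟨m, hm⟩ ⟨x, hx⟩
  · intro x hx
    rw [hz x hx]
    refine IsGreatest.isLUB ⟨?_, ?_⟩
    · obtain ⟨m, hm⟩ := huv.exists_left ⟨x, hx⟩
      refine ⟨m, m.2, ?_⟩
      dsimp only
      rw [hr m m.2, heq m ⟨x, hx⟩ hm]
      field_simp
    · rintro _ ⟨m, hm, rfl⟩
      dsimp only
      rw [hr m hm, one_div_mul_eq_div, div_le_iff₀ (Real.exp_pos _), mul_comm]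
      exact hle ⟨m, hm⟩ ⟨x, hx⟩
  · rw [hr m m.2, Real.log_exp, hU]
  · rw [hz x x.2, Real.log_exp, hV]

end Potentials

/-! ### Energy conservation as mass transport -/

section Energy

/-- The measure with density `f` on the subspace `s`. -/
noncomputable def densityOn {α : Type*} [MeasurableSpace α] (m : Measure α) (s : Set α)
    (f : α → ℝ) : Measure s :=
  (m.comap Subtype.val).withDensity fun x => ENNReal.ofReal (f x)

lemma densityOn_apply {α : Type*} [MeasurableSpace α] {m : Measure α} {s : Set α}
    (hs : MeasurableSet s) {f : α → ℝ} (hf : IntegrableOn f s m) (hf0 : ∀ x ∈ s, 0 ≤ f x)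
    {A : Set s} (hA : MeasurableSet A) :
    densityOn m s f A = ENNReal.ofReal (∫ x in Subtype.val '' A, f x ∂m) := by
  have hsub : Subtype.val '' A ⊆ s := by
    rintro _ ⟨x, -, rfl⟩
    exact x.2
  have hA' : MeasurableSet (Subtype.val '' A) := hs.subtype_image hA
  rw [densityOn, withDensity_apply _ hA, setLIntegral_subtype hs A fun x => ENNReal.ofReal (f x),
    ofReal_integral_eq_lintegral_ofReal (hf.mono_set hsub)]
  filter_upwards [ae_restrict_mem hA'] with x hx
  exact hf0 x (hsub hx)

lemma isFiniteMeasure_densityOn {α : Type*} [MeasurableSpace α] {m : Measure α} {s : Set α}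
    (hs : MeasurableSet s) {f : α → ℝ} (hf : IntegrableOn f s m) (hf0 : ∀ x ∈ s, 0 ≤ f x) :
    IsFiniteMeasure (densityOn m s f) :=
  ⟨by rw [densityOn_apply hs hf hf0 .univ]; exact ENNReal.ofReal_lt_top⟩

variable {ρ : Sphere2 → ℝ} {z : Plane → ℝ} {I : Sphere2 → ℝ} {L : Plane → ℝ}

/-- Energy conservation says that the reflector map transports `I dσ` to `L dx`. -/
theorem IsReflectorPair.isSolution_iff_map_eq (hR : IsReflectorPair ℓ D T ρ z)
    (h : Admissible ℓ D T) (hI_nonneg : ∀ m ∈ closure D, 0 ≤ I m)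
    (hI_int : IntegrableOn I (closure D) surfaceMeasure) (hL_nonneg : ∀ x ∈ closure T, 0 ≤ L x)
    (hL_int : IntegrableOn L (closure T) volume) {g : closure D → closure T} (hg : Measurable g)
    (hgc : ∀ᵐ m ∂(surfaceMeasure.comap (Subtype.val : closure D → Sphere2)),
      ∀ x, logK ℓ D T m x = Real.log (rhoHat ℓ ρ m) + Real.log (zTilde ℓ z x) ↔ x = g m) :
    IsSolution ℓ D T I L ρ z ↔
      (densityOn surfaceMeasure (closure D) I).map g = densityOn volume (closure T) L := by
  have hDm : MeasurableSet (closure D) := isClosed_closure.measurableSet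
  have hTm : MeasurableSet (closure T) := isClosed_closure.measurableSet
  -- `γ⁻¹(τ)` is, up to a null set, the preimage of `τ` under the measurable selection `g`.
  have hpre : ∀ τ : Set Plane, reflectorPreimage ℓ D T ρ z τ =ᵐ[surfaceMeasure]
      (Subtype.val '' (g ⁻¹' (Subtype.val ⁻¹' τ)) : Set Sphere2) := by
    intro τ
    have h1 : ∀ᵐ m ∂surfaceMeasure, ∀ hm : m ∈ closure D,
        reflectorMap ℓ T ρ z m = {(g ⟨m, hm⟩ : Plane)} := by
      have h2 : ∀ᵐ m ∂surfaceMeasure.restrict (closure D), ∀ hm : m ∈ closure D,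
          reflectorMap ℓ T ρ z m = {(g ⟨m, hm⟩ : Plane)} := by
        rw [ae_restrict_iff_subtype hDm]
        filter_upwards [hgc] with m hm _
        exact hR.reflectorMap_eq_singleton h hm
      filter_upwards [(ae_restrict_iff' hDm).1 h2] with m hm hmD
      exact hm hmD hmD
    filter_upwards [h1] with m hm
    apply propext
    change (m ∈ closure D ∧ _) ↔ m ∈ Subtype.val '' _
    constructor
    · rintro ⟨hmD, hne⟩
      rw [hm hmD, singleton_inter_nonempty] at hne
      exact ⟨⟨m, hmD⟩, hne, rfl⟩
    · rintro ⟨⟨m, hmD⟩, hmτ, rfl⟩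
      exact ⟨hmD, by rw [hm hmD, singleton_inter_nonempty]; exact hmτ⟩
  have hnonneg : ∀ {α : Type} [MeasurableSpace α] (m : Measure α) (s : Set α) (f : α → ℝ)
      (B : Set s), MeasurableSet s → MeasurableSet B → (∀ x ∈ s, 0 ≤ f x) →
      0 ≤ ∫ x in Subtype.val '' B, f x ∂m := fun m s f B hs hB hf =>
    setIntegral_nonneg (hs.subtype_image hB) (by rintro _ ⟨x, -, rfl⟩; exact hf x x.2)
  constructor
  · intro hS
    ext τ hτ
    have hτ' : MeasurableSet (Subtype.val '' τ : Set Plane) := hTm.subtype_image hτ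
    have he := hS.energy (Subtype.val '' τ) hτ' (by rintro _ ⟨x, -, rfl⟩; exact x.2)
    rw [setIntegral_congr_set (hpre _), preimage_image_eq _ Subtype.val_injective] at he
    rw [Measure.map_apply hg hτ, densityOn_apply hDm hI_int hI_nonneg (hg hτ),
      densityOn_apply hTm hL_int hL_nonneg hτ, he]
  · intro hmap
    refine ⟨hR, fun τ hτ hτT => ?_⟩
    have hτ' : MeasurableSet (Subtype.val ⁻¹' τ : Set (closure T)) := measurable_subtype_coe hτ
    have he := congrArg (fun m => m (Subtype.val ⁻¹' τ)) hmap
    simp only [Measure.map_apply hg hτ', densityOn_apply hDm hI_int hI_nonneg (hg hτ'),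
      densityOn_apply hTm hL_int hL_nonneg hτ'] at he
    rw [ENNReal.ofReal_eq_ofReal_iff (hnonneg _ _ _ _ hDm (hg hτ') hI_nonneg)
      (hnonneg _ _ _ _ hTm hτ' hL_nonneg)] at he
    rw [setIntegral_congr_set (hpre τ), he, Subtype.image_preimage_coe, inter_eq_right.2 hτT]

end Energy

end TwoReflector

open TwoReflector in
theorem mainTheorem1
    (D : Set TwoReflector.Sphere2) (hD_open : IsOpen D) (hD_ne : D.Nonempty)
    (hD_north : ∀ m ∈ closure D, m.1 ≠ !₂[(0 : ℝ), 0, 1])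
    (hD_south : ∀ m ∈ closure D, m.1 ≠ !₂[(0 : ℝ), 0, -1])
    (T : Set TwoReflector.Plane) (hT_open : IsOpen T) (hT_bdd : Bornology.IsBounded T)
    (hT_ne : T.Nonempty)
    (ℓ : ℝ) (hℓ_pos : 0 < ℓ) (hℓ_norm : ∀ x ∈ closure T, ‖x‖ < ℓ)
    (hℓ_kernel : ∀ m ∈ closure D, ∀ x ∈ closure T,
      0 < (ℓ - inner ℝ (TwoReflector.horiz m) x) /
        ((ℓ ^ 2 - ‖x‖ ^ 2) * (1 + TwoReflector.vert m)) - 1 / (2 * ℓ))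
    (I : TwoReflector.Sphere2 → ℝ) (hI_nonneg : ∀ m ∈ closure D, 0 ≤ I m)
    (hI_int : IntegrableOn I (closure D) TwoReflector.surfaceMeasure)
    (L : TwoReflector.Plane → ℝ) (hL_nonneg : ∀ x ∈ closure T, 0 ≤ L x)
    (hL_int : IntegrableOn L (closure T) volume)
    (h_energy : ∫ m in closure D, I m ∂TwoReflector.surfaceMeasure = ∫ x in closure T, L x) :
    (∃ (ρ : TwoReflector.Sphere2 → ℝ) (z : TwoReflector.Plane → ℝ),
      TwoReflector.IsSolution ℓ D T I L ρ z) ∧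
    (∀ (ρ : TwoReflector.Sphere2 → ℝ) (z : TwoReflector.Plane → ℝ),
      TwoReflector.IsSolution ℓ D T I L ρ z →
        (∃ C : NNReal, LipschitzOnWith C ρ (closure D)) ∧
        (∃ C : NNReal, LipschitzOnWith C z (closure T)) ∧
        (∀ᵐ m ∂TwoReflector.surfaceMeasure.restrict (closure D),
          ∃ x, TwoReflector.reflectorMap ℓ T ρ z m = {x})) ∧
    (∀ (ρ ρ' : TwoReflector.Sphere2 → ℝ) (z z' : TwoReflector.Plane → ℝ),
      TwoReflector.IsSolution ℓ D T I L ρ z → TwoReflector.IsSolution ℓ D T I L ρ' z' →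
        ∀ᵐ m ∂TwoReflector.surfaceMeasure.restrict (closure D), 0 < I m →
          TwoReflector.reflectorMap ℓ T ρ z m = TwoReflector.reflectorMap ℓ T ρ' z' m) := by
  have h : Admissible ℓ D T :=
    { pos := hℓ_pos
      isCompact_right := hT_bdd.isCompact_closure
      nonempty_left := hD_ne
      nonempty_right := hT_ne
      vert_pos := fun m hm => one_add_vert_pos (hD_south m hm)
      norm_lt := hℓ_norm
      kernelK_pos := fun m hm x hx => by
        have hδ : 0 < delta ℓ := by unfold delta; positivity
        have := mul_pos hδ (hℓ_kernel m hm x hx)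
        rw [mul_sub] at this
        rw [kernelK, sq (delta ℓ)]
        exact this }
  have hDm : MeasurableSet (closure D) := isClosed_closure.measurableSet
  have hTm : MeasurableSet (closure T) := isClosed_closure.measurableSet
  have : CompactSpace (closure D) := isCompact_iff_compactSpace.1 h.isCompact_left
  have : CompactSpace (closure T) := isCompact_iff_compactSpace.1 h.isCompact_right
  have : Nonempty (closure D) := hD_ne.closure.to_subtype
  have : Nonempty (closure T) := hT_ne.closure.to_subtype
  have : IsFiniteMeasure (densityOn surfaceMeasure (closure D) I) :=
    isFiniteMeasure_densityOn hDm hI_int hI_nonneg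
  have : IsFiniteMeasure (densityOn volume (closure T) L) :=
    isFiniteMeasure_densityOn hTm hL_int hL_nonneg
  have hac : densityOn surfaceMeasure (closure D) I ≪
      surfaceMeasure.comap (Subtype.val : closure D → Sphere2) :=
    withDensity_absolutelyContinuous _ _
  refine ⟨?_, fun ρ z hS => ?_, fun ρ ρ' z z' hS hS' => ?_⟩
  · have hmass : densityOn surfaceMeasure (closure D) I univ =
        densityOn volume (closure T) L univ := by
      rw [densityOn_apply hDm hI_int hI_nonneg .univ, densityOn_apply hTm hL_int hL_nonneg .univ,
        image_univ, image_univ, Subtype.range_coe, Subtype.range_coe, h_energy]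
    obtain ⟨C, hC⟩ := h.exists_lipschitzWith_logK
    obtain ⟨u, v, huv, hmin⟩ := exists_isConjugatePair_minimizer hmass h.continuous_logK hC
    obtain ⟨ρ, z, hR, hu, hv⟩ := exists_isReflectorPair h huv
    obtain ⟨g, hg, hgc⟩ := hR.exists_measurable_selection h
    refine ⟨ρ, z, (hR.isSolution_iff_map_eq h hI_nonneg hI_int hL_nonneg hL_int hg hgc).2 ?_⟩
    simp only [hu, hv] at hgc
    exact huv.map_eq_of_minimizer h.continuous_logK hmin hg (hac.ae_le hgc)
  · have hR := hS.isReflectorPair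
    obtain ⟨g, -, hgc⟩ := hR.exists_measurable_selection h
    refine ⟨hR.rho_lipschitz h, hR.z_lipschitz h, ?_⟩
    rw [ae_restrict_iff_subtype hDm]
    filter_upwards [hgc] with m hm
    exact ⟨_, hR.reflectorMap_eq_singleton h hm⟩
  · have hR := hS.isReflectorPair
    have hR' := hS'.isReflectorPair
    obtain ⟨g, hg, hgc⟩ := hR.exists_measurable_selection h
    obtain ⟨g', hg', hgc'⟩ := hR'.exists_measurable_selection h
    have hmap := (hR.isSolution_iff_map_eq h hI_nonneg hI_int hL_nonneg hL_int hg hgc).1 hS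
    have hmap' := (hR'.isSolution_iff_map_eq h hI_nonneg hI_int hL_nonneg hL_int hg' hgc').1 hS'
    have hgg' := (hR.isConjugatePair h).ae_eq_of_map_eq (hR'.isConjugatePair h) hg hg'
      (hac.ae_le hgc) (hac.ae_le hgc') (hmap.trans hmap'.symm)
    have hImeas : AEMeasurable (fun m : closure D => ENNReal.ofReal (I m))
        (surfaceMeasure.comap Subtype.val) :=
      ((aemeasurable_restrict_iff_comap_subtype hDm).1 hI_int.aemeasurable).ennreal_ofReal
    rw [ae_restrict_iff_subtype hDm]
    filter_upwards [(ae_withDensity_iff' hImeas).1 hgg', hgc, hgc'] with m hm hmc hmc' hpos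
    rw [hR.reflectorMap_eq_singleton h hmc, hR'.reflectorMap_eq_singleton h hmc',
      hm (ENNReal.ofReal_pos.2 hpos).ne']
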